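/- Let $p$ be an odd prime, let $\mathbb{F}$ be the algebraic closure of $\mathbb{F}_p$, and let $H=\langle x,y,z\rangle$ be the Heisenberg Lie algebra over $\mathbb{F}$, that is, the three-dimensional Lie algebra with $[x,y]=z$ and $[x,z]=[y,z]=0$. Let $\psi:H\to\mathfrak{gl}(I)$ be a faithful representation on an $\mathbb{F}$-vector space $I$, and let $L=H\ltimes_\psi I$ be the semidirect sum, in which $I$ is an abelian ideal, $H$ is a subalgebra and $[h,v]=\psi(h)(v)$ for $h\in H$, $v\in I$. Suppose that $L$ is not nilpotent and that $L$ has a non-singular derivation $\delta$ of finite order (i.e. $\delta^n=\mathrm{id}$ for some $n\ge 1$) such that $\delta(I)\le I$. Then $\dim I\ge p+3$. Moreover, the bound is sharp: for every odd prime $p$ there is a faithful representation of $H$ on an $\mathbb{F}$-vector space $I$ with $\dim I=p+3$ such that $H\ltimes I$ is not nilpotent and has a non-singular derivation of finite order that maps $I$ into $I$. -/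

import Mathlib

universe u v

/-- The Heisenberg Lie algebra over `F`: the three-dimensional Lie algebra with basis
`x, y, z`, in which `⁅x, y⁆ = z` and `⁅x, z⁆ = ⁅y, z⁆ = 0`. The element with coordinates
`a, b, c` is `a • x + b • y + c • z`. -/
@[ext] structure Heisenberg (F : Type u) : Type u where
  /-- The coordinate at `x`. -/
  cx : F
  /-- The coordinate at `y`. -/
  cy : F
  /-- The coordinate at `z`. -/
  cz : F

namespace Heisenberg

/-- As a type, the Heisenberg Lie algebra is `F × F × F`. -/
def toProd (F : Type u) : Heisenberg F ≃ F × F × F where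
  toFun a := ⟨a.cx, a.cy, a.cz⟩
  invFun a := ⟨a.1, a.2.1, a.2.2⟩
  left_inv _ := rfl
  right_inv _ := rfl

instance instAddCommGroup (F : Type u) [Field F] : AddCommGroup (Heisenberg F) :=
  (toProd F).addCommGroup

instance instModule (F : Type u) [Field F] : Module F (Heisenberg F) :=
  (toProd F).module F

/-- `⁅a, b⁆ = (a_x b_y - a_y b_x) z`. -/
instance instBracket (F : Type u) [Field F] : Bracket (Heisenberg F) (Heisenberg F) where
  bracket a b := ⟨0, 0, a.cx * b.cy - a.cy * b.cx⟩

theorem zero_def (F : Type u) [Field F] : (0 : Heisenberg F) = ⟨0, 0, 0⟩ := rfl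

theorem add_def {F : Type u} [Field F] (a b : Heisenberg F) :
    a + b = ⟨a.cx + b.cx, a.cy + b.cy, a.cz + b.cz⟩ := rfl

theorem smul_def {F : Type u} [Field F] (t : F) (a : Heisenberg F) :
    t • a = ⟨t * a.cx, t * a.cy, t * a.cz⟩ := rfl

theorem lie_def {F : Type u} [Field F] (a b : Heisenberg F) :
    ⁅a, b⁆ = ⟨0, 0, a.cx * b.cy - a.cy * b.cx⟩ := rfl

instance instLieRing (F : Type u) [Field F] : LieRing (Heisenberg F) where
  add_lie a b c := by
    ext <;> simp only [lie_def, add_def] <;> ring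
  lie_add a b c := by
    ext <;> simp only [lie_def, add_def] <;> ring
  lie_self a := by
    ext <;> simp [lie_def, zero_def, mul_comm]
  leibniz_lie a b c := by
    ext <;> simp only [lie_def, add_def] <;> ring

instance instLieAlgebra (F : Type u) [Field F] : LieAlgebra F (Heisenberg F) where
  lie_smul t a b := by
    ext <;> simp only [lie_def, smul_def] <;> ring

/-- The generator `x`. -/
def x (F : Type u) [Field F] : Heisenberg F := ⟨1, 0, 0⟩

/-- The generator `y`. -/
def y (F : Type u) [Field F] : Heisenberg F := ⟨0, 1, 0⟩

/-- The generator `z` of the centre. -/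
def z (F : Type u) [Field F] : Heisenberg F := ⟨0, 0, 1⟩

theorem eq_combination {F : Type u} [Field F] (a : Heisenberg F) :
    a = a.cx • x F + a.cy • y F + a.cz • z F := by
  ext <;> simp [x, y, z, add_def, smul_def]

theorem lie_x_y (F : Type u) [Field F] : ⁅x F, y F⁆ = z F := by
  ext <;> simp [lie_def, x, y, z]

theorem lie_x_z (F : Type u) [Field F] : ⁅x F, z F⁆ = 0 := by
  ext <;> simp [lie_def, x, z, zero_def]

theorem lie_y_z (F : Type u) [Field F] : ⁅y F, z F⁆ = 0 := by
  ext <;> simp [lie_def, y, z, zero_def]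

end Heisenberg

/-- Let the Lie algebra `H` act on the Lie algebra `I` through `ψ : H → Der I`. The semidirect
sum `H ⋉ I` (written `I ⋊⁅ψ⁆ H` in Mathlib) has a non-singular derivation `δ` of finite
multiplicative order (that is, `δ ^ n = 1` for some `n > 0`) with `δ(I) ≤ I`. -/
def HasNonsingularDerivation {F : Type u} [Field F] {H : Type*} [LieRing H] [LieAlgebra F H]
    {I : Type*} [LieRing I] [LieAlgebra F I] (ψ : H →ₗ⁅F⁆ LieDerivation F I I) : Prop :=
  ∃ δ : LieDerivation F (LieAlgebra.SemiDirectSum I H ψ) (LieAlgebra.SemiDirectSum I H ψ),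
    Function.Bijective δ ∧
    IsOfFinOrder (δ.toLinearMap : Module.End F (LieAlgebra.SemiDirectSum I H ψ)) ∧
    ∀ w : I, δ (LieAlgebra.SemiDirectSum.inl ψ w) ∈ (LieAlgebra.SemiDirectSum.inl ψ).range

/-! Lower bound. Write the order of δ as p^k·m with p ∤ m. In characteristic p the operator T =
δ^(p^k) is again a derivation; since T^m = 1, it is diagonalisable and invertible, and it preserves
I. Two eigenvectors of T whose H-components do not commute act on I by operators X and Y. With Z =
[X, Y] and D = T|_I, the operators X, Y, Z are homogeneous for D of non-zero degrees. Faithfulness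
gives Z ≠ 0. If X, Y, Z were all nilpotent, then all of H would act nilpotently
(`isNilpotent_combination`) and L would be nilpotent by Engel's theorem.

Dimensions are counted by traces: a commutator equal to a non-zero scalar forces p ∣ dim. Since p-th
powers of X, Y, Z commute with all the operators in play, their Fitting components are stable. If Z
is not nilpotent, its invertible component has dimension at least 2p, because p divides the
dimension of an eigenspace of Z and Z, having non-zero degree, is not scalar. If Z is nilpotent and
X, say, is not, the invertible component of X has dimension at least 2p, or exactly p with Z = 0 on
it; in the second case Z lives on the complement, which needs dimension 3.

Sharpness. A cyclic shift on F^p plus the 3 × 3 strictly triangular representation has dimension p +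
3, and a diagonal D with weights in λ + 𝔽_p grades it. -/

open Module

/-! ### Commutators, Fitting components and dimension counts in characteristic p. -/

section Operators

variable {F : Type*} [Field F] {V : Type*} [AddCommGroup V] [Module F V]

/-- If `[A, B]` commutes with `B`, then `A` commutes with `B ^ p` in characteristic `p`. -/
theorem commute_pow_char_of_commute_lie {R : Type*} [Ring R] {p : ℕ} (hR : (p : R) = 0)
    {A B C : R} (h : A * B - B * A = C) (hC : Commute C B) : Commute A (B ^ p) := by
  -- The derivative rule for [A, B^(k+1)]; at k + 1 = p its coefficient vanishes.
  have key : ∀ k : ℕ, A * B ^ (k + 1) = B ^ (k + 1) * A + ((k + 1 : ℕ) : R) * (C * B ^ k) := by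
    intro k
    induction k with
    | zero => simp [← h]
    | succ k ih =>
      have hBC : B ^ (k + 1) * C = C * B ^ (k + 1) := ((hC.pow_right (k + 1)).eq).symm
      have hAB : A * B = B * A + C := by rw [← h]; abel
      calc A * B ^ (k + 1 + 1) = (A * B ^ (k + 1)) * B := by rw [pow_succ B (k + 1), mul_assoc]
        _ = B ^ (k + 1) * (A * B) + ((k + 1 : ℕ) : R) * (C * B ^ (k + 1)) := by
          rw [ih, add_mul, mul_assoc, mul_assoc, mul_assoc, ← pow_succ]
        _ = _ := by
          rw [hAB, mul_add, hBC, ← mul_assoc, ← pow_succ, Nat.cast_succ (k + 1), add_mul, one_mul]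
          abel
  cases p with
  | zero => simp
  | succ k => rw [Commute, SemiconjBy, key k, hR, zero_mul, add_zero]

theorem natCast_end_eq_zero (p : ℕ) [CharP F p] : (p : End F V) = 0 := by
  ext v
  simp [Module.End.natCast_apply, ← Nat.cast_smul_eq_nsmul F]

/-- A commutator can be a non-zero scalar only in dimension divisible by the characteristic. -/
theorem dvd_finrank_of_lie_eq_smul_one {p : ℕ} [CharP F p] [FiniteDimensional F V]
    {A B : End F V} {c : F} (hc : c ≠ 0) (h : A * B - B * A = c • 1) : p ∣ finrank F V := by
  have h1 := congrArg (LinearMap.trace F V) h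
  rw [map_sub, LinearMap.trace_mul_comm, sub_self, map_smul, LinearMap.trace_one, smul_eq_mul] at h1
  exact (CharP.cast_eq_zero_iff F p _).1 ((mul_eq_zero.1 h1.symm).resolve_left hc)

/-- Since Z commutes with X, [X, Y Z⁻¹] = 1. -/
theorem dvd_finrank_of_isUnit_lie {p : ℕ} [CharP F p] [FiniteDimensional F V]
    {X Y Z : End F V} (h : X * Y - Y * X = Z) (hX : Commute Z X) (hZ : IsUnit Z) :
    p ∣ finrank F V := by
  obtain ⟨z, rfl⟩ := hZ
  refine dvd_finrank_of_lie_eq_smul_one (A := X) (B := Y * ↑z⁻¹) one_ne_zero ?_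
  rw [mul_assoc, (hX.units_inv_left).eq, ← mul_assoc, ← mul_assoc, ← sub_mul, h, one_smul,
    Units.mul_inv]

/-- Here [D X⁻¹, X] = [D, X] X⁻¹ = α. -/
theorem dvd_finrank_of_isUnit_of_lie_eq_smul {p : ℕ} [CharP F p] [FiniteDimensional F V]
    {D X : End F V} {α : F} (hα : α ≠ 0) (h : D * X - X * D = α • X) (hX : IsUnit X) :
    p ∣ finrank F V := by
  obtain ⟨x, rfl⟩ := hX
  refine dvd_finrank_of_lie_eq_smul_one (A := D * ↑x⁻¹) (B := x) hα ?_
  have : (x : End F V) * D = D * x - α • (x : End F V) := by rw [← h]; abel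
  rw [mul_assoc, Units.inv_mul, ← mul_assoc, this, sub_mul, mul_assoc, Units.mul_inv, smul_mul_assoc,
    Units.mul_inv]
  abel

theorem finrank_pos_of_ne_bot [FiniteDimensional F V] {W : Submodule F V} (h : W ≠ ⊥) :
    0 < finrank F W := by
  have := Submodule.nontrivial_iff_ne_bot.2 h
  exact finrank_pos

theorem isUnit_of_forall_eq_zero [FiniteDimensional F V] {T : End F V}
    (h : ∀ v, T v = 0 → v = 0) : IsUnit T := by
  rw [LinearMap.isUnit_iff_ker_eq_bot, LinearMap.ker_eq_bot']
  exact h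

/-- The Fitting decomposition of `P`. -/
theorem exists_fitting [FiniteDimensional F V] (P : End F V) :
    ∃ W₀ W₁ : Submodule F V, IsCompl W₀ W₁ ∧
      (∀ T, Commute T P → (∀ w ∈ W₀, T w ∈ W₀) ∧ (∀ w ∈ W₁, T w ∈ W₁)) ∧
      (∀ w ∈ W₁, P w = 0 → w = 0) ∧ (¬ IsNilpotent P → W₁ ≠ ⊥) := by
  -- N ≥ 1 is needed so that ker P lies in ker P^N, which meets the range trivially.
  obtain ⟨N, hN, hN1⟩ := ((LinearMap.eventually_isCompl_ker_pow_range_pow P).and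
    (Filter.eventually_ge_atTop 1)).exists
  refine ⟨_, _, hN, fun T hT => ⟨fun w hw => ?_, ?_⟩, fun w hw h => ?_, fun h hb => h ⟨N, ?_⟩⟩
  · have := LinearMap.congr_fun (hT.pow_right N).eq w
    simp only [Module.End.mul_apply] at this
    rw [LinearMap.mem_ker] at hw ⊢
    rw [← this, hw, map_zero]
  · rintro _ ⟨w, rfl⟩
    exact ⟨T w, (LinearMap.congr_fun (hT.pow_right N).eq w).symm⟩
  · refine (Submodule.disjoint_def.1 hN.disjoint) w ?_ hw
    obtain ⟨k, rfl⟩ : ∃ k, N = k + 1 := ⟨N - 1, by omega⟩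
    rw [LinearMap.mem_ker, pow_succ, Module.End.mul_apply, h, map_zero]
  · exact LinearMap.range_eq_bot.1 hb

theorem restrict_lie {X Y Z : End F V} (h : X * Y - Y * X = Z) {W : Submodule F V}
    (hX : ∀ w ∈ W, X w ∈ W) (hY : ∀ w ∈ W, Y w ∈ W) (hZ : ∀ w ∈ W, Z w ∈ W) :
    X.restrict hX * Y.restrict hY - Y.restrict hY * X.restrict hX = Z.restrict hZ := by
  ext w
  exact LinearMap.congr_fun h w

theorem restrict_commute {X Y : End F V} (h : Commute X Y) {W : Submodule F V}
    (hX : ∀ w ∈ W, X w ∈ W) (hY : ∀ w ∈ W, Y w ∈ W) :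
    Commute (X.restrict hX) (Y.restrict hY) := by
  ext w
  exact LinearMap.congr_fun h.eq w

theorem restrict_lie_smul {D X : End F V} {α : F} (h : D * X - X * D = α • X) {W : Submodule F V}
    (hD : ∀ w ∈ W, D w ∈ W) (hX : ∀ w ∈ W, X w ∈ W) :
    D.restrict hD * X.restrict hX - X.restrict hX * D.restrict hD = α • X.restrict hX := by
  ext w
  exact LinearMap.congr_fun h w

theorem restrict_isNilpotent {Z : End F V} (h : IsNilpotent Z) {W : Submodule F V}
    (hZ : ∀ w ∈ W, Z w ∈ W) : IsNilpotent (Z.restrict hZ) := by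
  obtain ⟨k, hk⟩ := h
  refine ⟨k, ?_⟩
  rw [Module.End.pow_restrict]
  ext w
  exact LinearMap.congr_fun hk w

theorem exists_ne_zero_of_isNilpotent {T : End F V} (hT : IsNilpotent T) {v : V} (hv : v ≠ 0) :
    ∃ k, (T ^ k) v ≠ 0 ∧ T ((T ^ k) v) = 0 := by
  classical
  have hex : ∃ k, (T ^ k) v = 0 := by
    obtain ⟨k, hk⟩ := hT
    exact ⟨k, by rw [hk]; rfl⟩
  obtain ⟨k, hk⟩ : ∃ k, Nat.find hex = k + 1 := by
    refine Nat.exists_eq_succ_of_ne_zero fun h0 => hv ?_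
    simpa [h0] using Nat.find_spec hex
  refine ⟨k, Nat.find_min hex (by omega), ?_⟩
  rw [← Module.End.mul_apply, ← pow_succ', ← hk]
  exact Nat.find_spec hex

/-- A linear combination of nilpotent operators `X`, `Y` and `Z = [X, Y]`, where `Z` is central,
is nilpotent. -/
theorem isNilpotent_combination {p : ℕ} [Fact p.Prime] [CharP F p] [FiniteDimensional F V]
    {X Y Z : End F V}
    (h : X * Y - Y * X = Z) (hZX : Commute Z X) (hZY : Commute Z Y)
    (nX : IsNilpotent X) (nY : IsNilpotent Y) (nZ : IsNilpotent Z) (s t u : F) :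
    IsNilpotent (s • X + t • Y + u • Z) := by
  by_contra hW
  set W : End F V := s • X + t • Y + u • Z with hWdef
  have hZW : Commute Z W :=
    ((hZX.smul_right s).add_right (hZY.smul_right t)).add_right ((Commute.refl Z).smul_right u)
  have hXW : X * W - W * X = t • Z := by
    simp only [hWdef, mul_add, add_mul, mul_smul_comm, smul_mul_assoc, ← h]
    rw [← sub_eq_zero]
    have := hZX.eq
    rw [← h] at this
    simp only [this, smul_sub]
    abel
  have hYW : Y * W - W * Y = (-s) • Z := by
    have := hZY.eq
    simp only [hWdef, mul_add, add_mul, mul_smul_comm, smul_mul_assoc, this]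
    simp only [← h, neg_smul, smul_sub]
    abel
  have h0 := natCast_end_eq_zero (F := F) (V := V) p
  have cX : Commute X (W ^ p) := commute_pow_char_of_commute_lie h0 hXW (hZW.smul_left t)
  have cY : Commute Y (W ^ p) := commute_pow_char_of_commute_lie h0 hYW (hZW.smul_left _)
  have cZ : Commute Z (W ^ p) := hZW.pow_right p
  -- W^p commutes with X, Y and Z, so they preserve its invertible component. A common null vector
  -- of the three found there is killed by W, a contradiction.
  obtain ⟨W₀, W₁, -, hst, hinj, hbot⟩ := exists_fitting (W ^ p)
  have hp0 : p ≠ 0 := (Fact.out : p.Prime).ne_zero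
  have hne := hbot fun hn => hW ((IsNilpotent.pow_iff_pos hp0).1 hn)
  obtain ⟨v₀, hv₀, hv₀0⟩ := Submodule.exists_mem_ne_zero_of_ne_bot hne
  have hst' : ∀ T, Commute T (W ^ p) → ∀ k : ℕ, ∀ w ∈ W₁, (T ^ k) w ∈ W₁ := fun T hT k =>
    (hst (T ^ k) (hT.pow_left k)).2
  obtain ⟨i, hi0, hi⟩ := exists_ne_zero_of_isNilpotent nZ hv₀0
  obtain ⟨j, hj0, hj⟩ := exists_ne_zero_of_isNilpotent nX hi0
  obtain ⟨k, hk0, hk⟩ := exists_ne_zero_of_isNilpotent nY hj0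
  set v₁ := (Z ^ i) v₀
  set v₂ := (X ^ j) v₁
  have hZ2 : Z v₂ = 0 := by
    rw [← Module.End.mul_apply, (hZX.pow_right j).eq, Module.End.mul_apply, hi, map_zero]
  have hZk : ∀ k : ℕ, Z ((Y ^ k) v₂) = 0 := fun k => by
    rw [← Module.End.mul_apply, (hZY.pow_right k).eq, Module.End.mul_apply, hZ2, map_zero]
  -- Applying Y does not leave ker X, because XY = YX + Z and Z already kills these vectors.
  have hXk : ∀ k : ℕ, X ((Y ^ k) v₂) = 0 := by
    intro k
    induction k with
    | zero => simpa using hj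
    | succ k ih =>
      have hXY : X * Y = Y * X + Z := by rw [← h]; abel
      rw [pow_succ', Module.End.mul_apply, ← Module.End.mul_apply, hXY, LinearMap.add_apply,
        Module.End.mul_apply, ih, hZk, map_zero, add_zero]
  refine hk0 (hinj _ (hst' Y cY k _ (hst' X cX j _ (hst' Z cZ i _ hv₀))) ?_)
  obtain ⟨q, hq⟩ := Nat.exists_eq_succ_of_ne_zero hp0
  rw [hq, Nat.succ_eq_add_one, pow_succ, Module.End.mul_apply]
  have : W ((Y ^ k) v₂) = 0 := by simp [hWdef, hXk, hZk, hk]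
  rw [this, map_zero]

/-- A non-zero nilpotent central commutator needs dimension at least `3`. -/
theorem three_le_finrank_of_lie_ne_zero [FiniteDimensional F V] {X Y Z : End F V}
    (h : X * Y - Y * X = Z) (hZX : Commute Z X) (hZY : Commute Z Y)
    (nZ : IsNilpotent Z) (hZ : Z ≠ 0) : 3 ≤ finrank F V := by
  -- In dimension at most 2, Z² = 0 and u, Zu is a basis. Operators commuting with Z are then
  -- polynomials in Z, so X and Y commute on u and Zu = 0.
  by_contra hlt
  obtain ⟨u, hu⟩ : ∃ u, Z u ≠ 0 := by
    by_contra! hall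
    exact hZ (LinearMap.ext hall)
  have hle : finrank F V ≤ 2 := by omega
  have hZZ : ∀ v, Z (Z v) = 0 := by
    intro v
    have h2 : Z ^ 2 = 0 := by
      have hch := LinearMap.aeval_self_charpoly Z
      rw [IsNilpotent.charpoly_eq_X_pow_finrank nZ, map_pow, Polynomial.aeval_X] at hch
      exact pow_eq_zero_of_le hle hch
    exact LinearMap.congr_fun h2 v
  have hli : LinearIndependent F ![u, Z u] := by
    rw [LinearIndependent.pair_iff]
    intro s t hst
    have h1 := congrArg Z hst
    simp only [map_add, map_smul, hZZ, smul_zero, add_zero, map_zero] at h1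
    have hs := (smul_eq_zero.1 h1).resolve_right hu
    subst hs
    simp only [zero_smul, zero_add] at hst
    exact ⟨rfl, (smul_eq_zero.1 hst).resolve_right hu⟩
  have hcard : Fintype.card (Fin 2) = finrank F V :=
    le_antisymm hli.fintype_card_le_finrank (by simpa using hle)
  have hspan := hli.span_eq_top_of_card_eq_finrank' hcard
  have hrep : ∀ T : End F V, ∃ a b : F, a • u + b • Z u = T u := by
    intro T
    have : T u ∈ Submodule.span F (Set.range ![u, Z u]) := hspan ▸ Submodule.mem_top
    rwa [Matrix.range_cons_cons_empty, Submodule.mem_span_pair] at this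
  obtain ⟨a, b, hab⟩ := hrep X
  obtain ⟨c, d, hcd⟩ := hrep Y
  have hXZ : X (Z u) = a • Z u := by
    rw [← Module.End.mul_apply, ← hZX.eq, Module.End.mul_apply, ← hab]
    simp [hZZ]
  have hYZ : Y (Z u) = c • Z u := by
    rw [← Module.End.mul_apply, ← hZY.eq, Module.End.mul_apply, ← hcd]
    simp [hZZ]
  refine hu ?_
  nth_rewrite 1 [← h]
  rw [LinearMap.sub_apply, Module.End.mul_apply, Module.End.mul_apply, ← hab, ← hcd]
  simp only [map_add, map_smul, hXZ, hYZ, ← hab, ← hcd]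
  module

/-- If `Z = [X, Y]` is central and invertible, and has non-zero degree for `D`,
then the dimension is at least `2p`. -/
theorem two_mul_le_finrank_of_isUnit_lie {p : ℕ} [CharP F p] [IsAlgClosed F]
    [FiniteDimensional F V] [Nontrivial V]
    {X Y Z D : End F V} {γ : F} (h : X * Y - Y * X = Z) (hZX : Commute Z X) (hZY : Commute Z Y)
    (hγ : γ ≠ 0) (hD : D * Z - Z * D = γ • Z) (hZ : IsUnit Z) : 2 * p ≤ finrank F V := by
  obtain ⟨ζ, hζ⟩ := Module.End.exists_eigenvalue Z
  have hinj : ∀ v, Z v = 0 → v = 0 := LinearMap.ker_eq_bot'.1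
    ((LinearMap.isUnit_iff_ker_eq_bot Z).1 hZ)
  set E := Module.End.eigenspace Z ζ with hE
  have hst : ∀ T : End F V, Commute Z T → ∀ w ∈ E, T w ∈ E := by
    intro T hT w hw
    rw [hE, Module.End.mem_eigenspace_iff] at hw ⊢
    rw [← Module.End.mul_apply, hT.eq, Module.End.mul_apply, hw, map_smul]
  have hEp : p ∣ finrank F E :=
    dvd_finrank_of_isUnit_lie (restrict_lie h (hst X hZX) (hst Y hZY) (hst Z rfl))
      (restrict_commute hZX _ _) <| isUnit_of_forall_eq_zero fun v hv =>
        Subtype.ext (hinj _ (congrArg Subtype.val hv))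
  have hVp : p ∣ finrank F V := dvd_finrank_of_isUnit_lie h hZX hZ
  have hE0 : 0 < finrank F E := finrank_pos_of_ne_bot hζ
  by_contra hlt
  have hle : finrank F E ≤ finrank F V := Submodule.finrank_le E
  -- Both dimensions are positive multiples of p below 2p, hence equal: Z would be a scalar, which D
  -- cannot rescale.
  have heq : finrank F E = finrank F V := by
    obtain ⟨a, ha⟩ := hEp
    obtain ⟨b, hb⟩ := hVp
    have hb2 : b < 2 := by
      by_contra! hb2
      nlinarith
    have ha0 : 0 < a := by
      rcases Nat.eq_zero_or_pos a with rfl | h' <;> simp_all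
    have hb1 : b ≤ a := by omega
    nlinarith
  have htop := Submodule.eq_top_of_finrank_eq heq
  have hZs : Z = ζ • 1 := by
    ext v
    have : v ∈ E := htop ▸ Submodule.mem_top
    simpa using Module.End.mem_eigenspace_iff.1 this
  rw [hZs] at hD
  obtain ⟨v, hv⟩ := exists_ne (0 : V)
  have h1 := LinearMap.congr_fun hD v
  simp only [mul_smul_comm, mul_one, smul_mul_assoc, one_mul, sub_self, LinearMap.zero_apply] at h1
  refine hv (hinj v ?_)
  rw [hZs]
  exact (smul_eq_zero.1 h1.symm).resolve_left hγ

/-- If `X` is invertible of non-zero degree for `D` and the dimension is less than `2p`, then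
any homogeneous nilpotent operator that commutes with `X` vanishes. -/
theorem eq_zero_of_isNilpotent_of_isUnit {p : ℕ} [CharP F p] [FiniteDimensional F V]
    {X Z D : End F V} {α γ : F} (hα : α ≠ 0) (hX : D * X - X * D = α • X) (uX : IsUnit X)
    (hlt : finrank F V < 2 * p) (hZX : Commute Z X) (hZ : D * Z - Z * D = γ • Z)
    (nZ : IsNilpotent Z) : Z = 0 := by
  rcases subsingleton_or_nontrivial V with hV | hV
  · exact Subsingleton.elim _ _
  have hinj : ∀ v, X v = 0 → v = 0 := LinearMap.ker_eq_bot'.1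
    ((LinearMap.isUnit_iff_ker_eq_bot X).1 uX)
  have hXK : ∀ w ∈ LinearMap.ker Z, X w ∈ LinearMap.ker Z := fun w hw => by
    rw [LinearMap.mem_ker] at hw ⊢
    rw [← Module.End.mul_apply, hZX.eq, Module.End.mul_apply, hw, map_zero]
  have hDK : ∀ w ∈ LinearMap.ker Z, D w ∈ LinearMap.ker Z := fun w hw => by
    rw [LinearMap.mem_ker] at hw ⊢
    have h1 := LinearMap.congr_fun hZ w
    simpa [hw] using h1
  -- ker Z is stable under X and D, so the trace argument applies to it as well as to V.
  have hKp : p ∣ finrank F (LinearMap.ker Z) :=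
    dvd_finrank_of_isUnit_of_lie_eq_smul hα (restrict_lie_smul hX hDK hXK) <|
      isUnit_of_forall_eq_zero fun v hv => Subtype.ext (hinj _ (congrArg Subtype.val hv))
  have hVp : p ∣ finrank F V := dvd_finrank_of_isUnit_of_lie_eq_smul hα hX uX
  have hK0 : 0 < finrank F (LinearMap.ker Z) := by
    obtain ⟨v, hv⟩ := exists_ne (0 : V)
    obtain ⟨k, hk0, hk⟩ := exists_ne_zero_of_isNilpotent nZ hv
    exact finrank_pos_of_ne_bot (Submodule.ne_bot_iff _ |>.2 ⟨_, hk, hk0⟩)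
  have hle := Submodule.finrank_le (LinearMap.ker Z)
  refine LinearMap.ker_eq_top.1 (Submodule.eq_top_of_finrank_eq ?_)
  obtain ⟨a, ha⟩ := hKp
  obtain ⟨b, hb⟩ := hVp
  have hb2 : b < 2 := by
    by_contra! hb2
    nlinarith
  have ha0 : 0 < a := by
    rcases Nat.eq_zero_or_pos a with rfl | h' <;> simp_all
  have hb1 : b ≤ a := by omega
  nlinarith

/-- V splits into the Fitting components of X^p. The invertible one has dimension divisible by p; if
this is less than 2p, Z vanishes there and must be non-zero on the other one, which contributes at
least 3. -/
theorem add_three_le_finrank_of_not_isNilpotent_left {p : ℕ} [Fact p.Prime] (hp : Odd p)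
    [CharP F p] [FiniteDimensional F V] {X Y Z D : End F V} {α γ : F}
    (h : X * Y - Y * X = Z) (hZX : Commute Z X) (hZY : Commute Z Y)
    (hα : α ≠ 0) (hDX : D * X - X * D = α • X) (hDZ : D * Z - Z * D = γ • Z)
    (hZ : Z ≠ 0) (nZ : IsNilpotent Z) (nX : ¬ IsNilpotent X) : p + 3 ≤ finrank F V := by
  have hp3 : 3 ≤ p := by
    have := (Fact.out : p.Prime).two_le
    obtain ⟨k, rfl⟩ := hp
    omega
  have h0 := natCast_end_eq_zero (F := F) (V := V) p
  have cX : Commute X (X ^ p) := (Commute.refl X).pow_right p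
  have cZ : Commute Z (X ^ p) := hZX.pow_right p
  have cY : Commute Y (X ^ p) := by
    refine commute_pow_char_of_commute_lie h0 (C := -Z) ?_ hZX.neg_left
    rw [← h]; abel
  have cD : Commute D (X ^ p) :=
    commute_pow_char_of_commute_lie h0 hDX ((Commute.refl X).smul_left α)
  obtain ⟨W₀, W₁, hc, hst, hinj, hbot⟩ := exists_fitting (X ^ p)
  have hne := hbot fun hn => nX ((IsNilpotent.pow_iff_pos (by omega)).1 hn)
  have hdim := Submodule.finrank_add_eq_of_isCompl hc
  have hpos : 0 < finrank F W₁ := finrank_pos_of_ne_bot hne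
  have uX : IsUnit (X.restrict (hst X cX).2) := isUnit_of_forall_eq_zero fun v hv => by
    refine Subtype.ext (hinj _ v.2 ?_)
    have hv' : X v = 0 := congrArg Subtype.val hv
    obtain ⟨q, rfl⟩ : ∃ q, p = q + 1 := ⟨p - 1, by omega⟩
    rw [pow_succ, Module.End.mul_apply, hv', map_zero]
  have hlie := restrict_lie_smul hDX (hst D cD).2 (hst X cX).2
  have hdvd : p ∣ finrank F W₁ := dvd_finrank_of_isUnit_of_lie_eq_smul hα hlie uX
  have hpW : p ≤ finrank F W₁ := Nat.le_of_dvd hpos hdvd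
  by_cases hlt : finrank F W₁ < 2 * p
  · have hZ1 : Z.restrict (hst Z cZ).2 = 0 :=
      eq_zero_of_isNilpotent_of_isUnit hα hlie uX hlt (restrict_commute hZX _ _)
        (restrict_lie_smul hDZ (hst D cD).2 (hst Z cZ).2) (restrict_isNilpotent nZ _)
    have hZ0 : Z.restrict (hst Z cZ).1 ≠ 0 := by
      intro hZ0
      refine hZ (LinearMap.ker_eq_top.1 (eq_top_iff.2 ?_))
      rw [← hc.sup_eq_top, sup_le_iff]
      exact ⟨fun w hw => congrArg Subtype.val (LinearMap.congr_fun hZ0 ⟨w, hw⟩),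
        fun w hw => congrArg Subtype.val (LinearMap.congr_fun hZ1 ⟨w, hw⟩)⟩
    have := three_le_finrank_of_lie_ne_zero
      (restrict_lie h (hst X cX).1 (hst Y cY).1 (hst Z cZ).1)
      (restrict_commute hZX _ _) (restrict_commute hZY _ _) (restrict_isNilpotent nZ _) hZ0
    omega
  · omega

/-- A module of the Heisenberg algebra with a compatible operator `D`, on which `Z` is non-zero
and one of `X`, `Y`, `Z` is not nilpotent, has dimension at least `p + 3`. -/
theorem add_three_le_finrank {p : ℕ} [Fact p.Prime] (hp : Odd p)
    [CharP F p] [IsAlgClosed F] [FiniteDimensional F V] {X Y Z D : End F V} {α β γ : F}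
    (h : X * Y - Y * X = Z) (hZX : Commute Z X) (hZY : Commute Z Y)
    (hα : α ≠ 0) (hβ : β ≠ 0) (hγ : γ ≠ 0)
    (hDX : D * X - X * D = α • X) (hDY : D * Y - Y * D = β • Y) (hDZ : D * Z - Z * D = γ • Z)
    (hZ : Z ≠ 0) (hn : ¬ (IsNilpotent X ∧ IsNilpotent Y ∧ IsNilpotent Z)) :
    p + 3 ≤ finrank F V := by
  by_cases nZ : IsNilpotent Z
  · by_cases nX : IsNilpotent X
    · have nY : ¬ IsNilpotent Y := fun nY => hn ⟨nX, nY, nZ⟩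
      -- Exchange X and Y; the commutator becomes -Z.
      refine add_three_le_finrank_of_not_isNilpotent_left hp (X := Y) (Y := X) (Z := -Z) (γ := γ)
        (by rw [← h]; abel) hZY.neg_left hZX.neg_left hβ hDY ?_ (neg_ne_zero.2 hZ) nZ.neg nY
      rw [smul_neg, ← hDZ]
      simp only [mul_neg, neg_mul]
      abel
    · exact add_three_le_finrank_of_not_isNilpotent_left hp h hZX hZY hα hDX hDZ hZ nZ nX
  · have hp3 : 3 ≤ p := by
      have := (Fact.out : p.Prime).two_le
      obtain ⟨k, rfl⟩ := hp
      omega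
    have h0 := natCast_end_eq_zero (F := F) (V := V) p
    have cD : Commute D (Z ^ p) :=
      commute_pow_char_of_commute_lie h0 hDZ ((Commute.refl Z).smul_left γ)
    obtain ⟨W₀, W₁, -, hst, hinj, hbot⟩ := exists_fitting (Z ^ p)
    have hne := hbot fun hn => nZ ((IsNilpotent.pow_iff_pos (by omega)).1 hn)
    have : Nontrivial W₁ := Submodule.nontrivial_iff_ne_bot.2 hne
    have cX := (hst X (hZX.symm.pow_right p)).2
    have cY := (hst Y (hZY.symm.pow_right p)).2
    have cZ := (hst Z ((Commute.refl Z).pow_right p)).2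
    have := two_mul_le_finrank_of_isUnit_lie (p := p) (restrict_lie h cX cY cZ)
      (restrict_commute hZX _ _) (restrict_commute hZY _ _) hγ
      (restrict_lie_smul hDZ (hst D cD).2 cZ) <| isUnit_of_forall_eq_zero fun v hv => by
        refine Subtype.ext (hinj _ v.2 ?_)
        have hv' : Z v = 0 := congrArg Subtype.val hv
        obtain ⟨q, rfl⟩ : ∃ q, p = q + 1 := ⟨p - 1, by omega⟩
        rw [pow_succ, Module.End.mul_apply, hv', map_zero]
    have := Submodule.finrank_le W₁
    omega

end Operators

/-! ### From the derivation to graded operators on I: the lower bound. -/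

section LowerBound

instance Heisenberg.instFiniteDimensional (F : Type*) [Field F] :
    FiniteDimensional F (Heisenberg F) :=
  Module.Finite.equiv ({ Heisenberg.toProd F with
    map_add' := fun _ _ => rfl
    map_smul' := fun _ _ => rfl } : Heisenberg F ≃ₗ[F] F × F × F).symm

variable {F : Type*} [Field F]

/-- The `p ^ k`-th power of a derivation is a derivation in characteristic `p`. -/
theorem LieDerivation.pow_char_pow_apply_lie {p : ℕ} [Fact p.Prime] [CharP F p] {L : Type*}
    [LieRing L] [LieAlgebra F L] (δ : LieDerivation F L L) (k : ℕ) (a b : L) :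
    (δ.toLinearMap ^ p ^ k : End F L) ⁅a, b⁆ =
      ⁅a, (δ.toLinearMap ^ p ^ k : End F L) b⁆ + ⁅(δ.toLinearMap ^ p ^ k : End F L) a, b⁆ := by
  have hit : ∀ (n : ℕ) (c : L), (δ.toLinearMap ^ n : End F L) c = δ^[n] c := fun n c => by
    rw [Module.End.pow_apply]; rfl
  have hq : 0 < p ^ k := pow_pos (Fact.out : p.Prime).pos k
  obtain ⟨q, hq'⟩ : ∃ q, p ^ k = q + 1 := ⟨p ^ k - 1, by omega⟩
  -- In the Leibniz formula only the two end terms survive: p divides the inner binomial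
  -- coefficients of p^k.
  rw [hit, hit, hit, δ.iterate_apply_lie', hq', Finset.sum_range_succ, Finset.sum_range_succ',
    Finset.sum_eq_zero]
  · simp
  · intro i hi
    rw [Finset.mem_range] at hi
    rw [← Nat.cast_smul_eq_nsmul F, (CharP.cast_eq_zero_iff F p _).2, zero_smul]
    rw [← hq']
    exact (Fact.out : p.Prime).dvd_choose_pow (by omega) (by omega)

/-- X^m - 1 is separable when m ≠ 0 in F, so T is semisimple. -/
theorem iSup_eigenspace_eq_top_of_pow_eq_one [IsAlgClosed F] {V : Type*} [AddCommGroup V]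
    [Module F V] [FiniteDimensional F V] {T : End F V} {m : ℕ} (hm : (m : F) ≠ 0)
    (hT : T ^ m = 1) : ⨆ μ, T.eigenspace μ = ⊤ := by
  have hs : T.IsSemisimple := by
    refine Module.End.isSemisimple_of_squarefree_aeval_eq_zero
      (Polynomial.separable_X_pow_sub_C (1 : F) hm one_ne_zero).squarefree ?_
    simp [hT]
  rw [← Module.End.iSup_maxGenEigenspace_eq_top T]
  exact iSup_congr fun μ => (hs.isFinitelySemisimple.maxGenEigenspace_eq_eigenspace μ).symm

theorem exists_eigenvectors_ne_zero {V M : Type*} [AddCommGroup V] [Module F V]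
    [AddCommGroup M] [Module F M] {T : End F V} (hT : ⨆ μ, T.eigenspace μ = ⊤)
    {B : V →ₗ[F] V →ₗ[F] M} (hB : B ≠ 0) :
    ∃ (u v : V) (α β : F), T u = α • u ∧ T v = β • v ∧ B u v ≠ 0 := by
  by_contra! hall
  refine hB (LinearMap.ext fun u => ?_)
  refine LinearMap.ext fun v => ?_
  have h1 : ∀ v β, T v = β • v → B.flip v = 0 := fun v β hv => by
    by_contra hne
    have : ⨆ μ, T.eigenspace μ ≤ LinearMap.ker (B.flip v) :=
      iSup_le fun μ u hu => hall u v μ β (Module.End.mem_eigenspace_iff.1 hu) hv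
    rw [hT, top_le_iff] at this
    exact hne (LinearMap.ker_eq_top.1 this)
  have h2 : ⨆ μ, T.eigenspace μ ≤ LinearMap.ker B.flip :=
    iSup_le fun μ w hw => h1 w μ (Module.End.mem_eigenspace_iff.1 hw)
  rw [hT, top_le_iff] at h2
  exact LinearMap.congr_fun (LinearMap.congr_fun (LinearMap.ker_eq_top.1 h2) v) u

variable {I : Type*} [LieRing I] [LieAlgebra F I]

/-- The linear operators of a homomorphism to the derivations of an abelian Lie algebra. -/
abbrev Heisenberg.op (ψ : Heisenberg F →ₗ⁅F⁆ LieDerivation F I I) (h : Heisenberg F) : End F I :=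
  (ψ h).toLinearMap

theorem Heisenberg.op_lie (ψ : Heisenberg F →ₗ⁅F⁆ LieDerivation F I I) (a b : Heisenberg F) :
    Heisenberg.op ψ a * Heisenberg.op ψ b - Heisenberg.op ψ b * Heisenberg.op ψ a = Heisenberg.op ψ ⁅a, b⁆ := by
  ext w
  simp [Heisenberg.op, Ring.lie_def]

theorem Heisenberg.op_lie_commute (ψ : Heisenberg F →ₗ⁅F⁆ LieDerivation F I I) (a b c : Heisenberg F) :
    Commute (Heisenberg.op ψ ⁅a, b⁆) (Heisenberg.op ψ c) := by
  rw [commute_iff_lie_eq, Ring.lie_def, Heisenberg.op_lie]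
  have : ⁅⁅a, b⁆, c⁆ = 0 := by simp [Heisenberg.lie_def, Heisenberg.zero_def]
  rw [this]
  ext w
  simp [Heisenberg.op]

theorem Heisenberg.op_add (ψ : Heisenberg F →ₗ⁅F⁆ LieDerivation F I I) (a b : Heisenberg F) :
    Heisenberg.op ψ (a + b) = Heisenberg.op ψ a + Heisenberg.op ψ b := by
  ext w; simp [Heisenberg.op]

theorem Heisenberg.op_smul (ψ : Heisenberg F →ₗ⁅F⁆ LieDerivation F I I) (s : F) (a : Heisenberg F) :
    Heisenberg.op ψ (s • a) = s • Heisenberg.op ψ a := by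
  ext w; simp [Heisenberg.op]

/-- Cramer's rule modulo the centre; the central coordinate is then corrected. -/
theorem Heisenberg.exists_eq_combination {a b : Heisenberg F} (hab : ⁅a, b⁆ ≠ 0)
    (c : Heisenberg F) : ∃ s t r : F, c = s • a + t • b + r • ⁅a, b⁆ := by
  have hd : a.cx * b.cy - a.cy * b.cx ≠ 0 := fun h0 => hab (by
    simp [Heisenberg.lie_def, Heisenberg.zero_def, h0])
  set d := a.cx * b.cy - a.cy * b.cx with hdd
  set s := (c.cx * b.cy - c.cy * b.cx) / d with hs
  set t := (a.cx * c.cy - a.cy * c.cx) / d with ht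
  refine ⟨s, t, (c.cz - s * a.cz - t * b.cz) / d, ?_⟩
  ext <;> simp only [Heisenberg.add_def, Heisenberg.smul_def, Heisenberg.lie_def, ← hdd]
  · rw [hs, ht]; field_simp; rw [hdd]; ring
  · rw [hs, ht]; field_simp; rw [hdd]; ring
  · field_simp; ring

/-- The semidirect sum is nilpotent as soon as `H` acts by nilpotent operators. -/
theorem isNilpotent_semiDirectSum [IsLieAbelian I] [FiniteDimensional F I]
    (ψ : Heisenberg F →ₗ⁅F⁆ LieDerivation F I I) (h : ∀ c, IsNilpotent (Heisenberg.op ψ c)) :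
    LieRing.IsNilpotent (LieAlgebra.SemiDirectSum I (Heisenberg F) ψ) := by
  have : FiniteDimensional F (LieAlgebra.SemiDirectSum I (Heisenberg F) ψ) :=
    Module.Finite.equiv (LieAlgebra.SemiDirectSum.toProdl ψ).symm
  rw [LieAlgebra.isNilpotent_iff_forall (R := F)]
  intro g
  obtain ⟨k, hk⟩ := h g.right
  have hpow : ∀ (n : ℕ) (w : I), ((LieAlgebra.ad F _ g) ^ n) (LieAlgebra.SemiDirectSum.inl ψ w) =
      LieAlgebra.SemiDirectSum.inl ψ ((Heisenberg.op ψ g.right ^ n) w) := by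
    intro n
    induction n with
    | zero => intro w; simp
    | succ n ih =>
      intro w
      rw [pow_succ, Module.End.mul_apply, pow_succ, Module.End.mul_apply, ← ih]
      congr 1
      ext <;> simp [Heisenberg.op, trivial_lie_zero]
  -- Two brackets with g land in I, as H has class 2; k more kill I.
  refine ⟨k + 2, LinearMap.ext fun l => ?_⟩
  rw [pow_add, Module.End.mul_apply]
  have h2 : ∃ w, ((LieAlgebra.ad F _ g) ^ 2) l = LieAlgebra.SemiDirectSum.inl ψ w := by
    refine ⟨(((LieAlgebra.ad F _ g) ^ 2) l).left, ?_⟩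
    ext
    · rfl
    all_goals simp [pow_two, Heisenberg.lie_def, Heisenberg.zero_def]
  obtain ⟨w, hw⟩ := h2
  rw [hw, hpow, hk]
  simp

/-- Take T = δ^(p^k), the part of δ of order prime to p. -/
theorem HasNonsingularDerivation.exists_semisimple {p : ℕ} [Fact p.Prime]
    [CharP F p] [IsAlgClosed F] [FiniteDimensional F I]
    {ψ : Heisenberg F →ₗ⁅F⁆ LieDerivation F I I} (hδ : HasNonsingularDerivation ψ) :
    ∃ T : End F (LieAlgebra.SemiDirectSum I (Heisenberg F) ψ),
      (⨆ μ, T.eigenspace μ = ⊤) ∧ (∀ a b, T ⁅a, b⁆ = ⁅a, T b⁆ + ⁅T a, b⁆) ∧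
      (∀ w : I, ∃ w', T (LieAlgebra.SemiDirectSum.inl ψ w) = LieAlgebra.SemiDirectSum.inl ψ w') ∧
      ∀ l, T l = 0 → l = 0 := by
  have : FiniteDimensional F (LieAlgebra.SemiDirectSum I (Heisenberg F) ψ) :=
    Module.Finite.equiv (LieAlgebra.SemiDirectSum.toProdl ψ).symm
  obtain ⟨δ, -, hfin, hI⟩ := hδ
  obtain ⟨n, hn, hδn⟩ := isOfFinOrder_iff_pow_eq_one.1 hfin
  obtain ⟨k, m, hpm, hkm⟩ := Nat.exists_eq_pow_mul_and_not_dvd hn.ne' p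
    (Fact.out : p.Prime).ne_one
  have hT1 : (δ.toLinearMap ^ p ^ k : End F _) ^ m = 1 := by rw [← pow_mul, ← hkm, hδn]
  have hTlie := δ.pow_char_pow_apply_lie (p := p) k
  have hTI : ∀ w : I, ∃ w', (δ.toLinearMap ^ p ^ k : End F _) (LieAlgebra.SemiDirectSum.inl ψ w) =
      LieAlgebra.SemiDirectSum.inl ψ w' := by
    generalize p ^ k = q
    induction q with
    | zero => exact fun w => ⟨w, by simp⟩
    | succ q ih =>
      intro w
      obtain ⟨w', hw'⟩ := ih w
      obtain ⟨w'', hw''⟩ := hI w'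
      exact ⟨w'', by rw [pow_succ', Module.End.mul_apply, hw']; exact hw''.symm⟩
  have hm0 : m ≠ 0 := by
    rintro rfl
    omega
  have hTinj : ∀ l, (δ.toLinearMap ^ p ^ k : End F _) l = 0 → l = 0 := fun l hl => by
    obtain ⟨j, rfl⟩ := Nat.exists_eq_succ_of_ne_zero hm0
    have := LinearMap.congr_fun hT1 l
    rw [Nat.succ_eq_add_one, pow_succ, Module.End.mul_apply, hl, map_zero] at this
    exact this.symm
  exact ⟨_, iSup_eigenspace_eq_top_of_pow_eq_one
    (fun h0 => hpm ((CharP.cast_eq_zero_iff F p m).1 h0)) hT1, hTlie, hTI, hTinj⟩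

/-- The bracket of H, pulled back to L, is a non-zero bilinear map, so it cannot vanish on all pairs
from a spanning set of eigenvectors. -/
theorem exists_eigenvectors_lie_right_ne_zero {ψ : Heisenberg F →ₗ⁅F⁆ LieDerivation F I I}
    {T : End F (LieAlgebra.SemiDirectSum I (Heisenberg F) ψ)} (htop : ⨆ μ, T.eigenspace μ = ⊤) :
    ∃ (a b : LieAlgebra.SemiDirectSum I (Heisenberg F) ψ) (α β : F),
      T a = α • a ∧ T b = β • b ∧ ⁅a.right, b.right⁆ ≠ 0 := by
  let π := (LieAlgebra.SemiDirectSum.projr ψ :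
    LieAlgebra.SemiDirectSum I (Heisenberg F) ψ →ₗ[F] Heisenberg F)
  let B := ((LieAlgebra.ad F (Heisenberg F) : Heisenberg F →ₗ[F] End F (Heisenberg F)).compl₁₂ π π)
  have hBapp : ∀ a b, B a b = ⁅a.right, b.right⁆ := fun a b => rfl
  have hB : B ≠ 0 := fun h0 => by
    have h1 : B ⟨0, Heisenberg.x F⟩ ⟨0, Heisenberg.y F⟩ = 0 := by rw [h0]; rfl
    rw [hBapp, Heisenberg.lie_x_y] at h1
    exact one_ne_zero (congrArg Heisenberg.cz h1)
  exact exists_eigenvectors_ne_zero htop hB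

theorem exists_restrict_inl {ψ : Heisenberg F →ₗ⁅F⁆ LieDerivation F I I}
    {T : End F (LieAlgebra.SemiDirectSum I (Heisenberg F) ψ)}
    (hTI : ∀ w : I, ∃ w', T (LieAlgebra.SemiDirectSum.inl ψ w) =
      LieAlgebra.SemiDirectSum.inl ψ w') :
    ∃ D : End F I, ∀ w, T (LieAlgebra.SemiDirectSum.inl ψ w) =
      LieAlgebra.SemiDirectSum.inl ψ (D w) := by
  let D : End F I := (LieAlgebra.SemiDirectSum.projl ψ) ∘ₗ T ∘ₗ
    (LieAlgebra.SemiDirectSum.inl ψ :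
      I →ₗ[F] LieAlgebra.SemiDirectSum I (Heisenberg F) ψ)
  refine ⟨D, fun w => ?_⟩
  obtain ⟨w', hw'⟩ := hTI w
  have : D w = w' := congrArg LieAlgebra.SemiDirectSum.left hw'
  rw [this, hw']

theorem add_three_le_finrank_of_hasNonsingularDerivation {p : ℕ} [Fact p.Prime] (hp : Odd p)
    [CharP F p] [IsAlgClosed F] [IsLieAbelian I] [FiniteDimensional F I]
    (ψ : Heisenberg F →ₗ⁅F⁆ LieDerivation F I I) (hψ : Function.Injective ψ)
    (hnil : ¬ LieRing.IsNilpotent (LieAlgebra.SemiDirectSum I (Heisenberg F) ψ))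
    (hδ : HasNonsingularDerivation ψ) : p + 3 ≤ finrank F I := by
  obtain ⟨T, htop, hTlie, hTI, hTinj⟩ := hδ.exists_semisimple (p := p)
  obtain ⟨a, b, α, β, ha, hb, hab⟩ := exists_eigenvectors_lie_right_ne_zero htop
  have hc : T ⁅a, b⁆ = (α + β) • ⁅a, b⁆ := by
    rw [hTlie, ha, hb, lie_smul, smul_lie, ← add_smul, add_comm]
  have hc0 : ⁅a, b⁆ ≠ 0 := fun h0 => hab (congrArg LieAlgebra.SemiDirectSum.right h0)
  have hne : ∀ (l) (μ : F), T l = μ • l → l ≠ 0 → μ ≠ 0 := fun l μ hl hl0 hμ =>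
    hl0 (hTinj l (by rw [hl, hμ, zero_smul]))
  have ha0 : a ≠ 0 := fun h0 => hc0 (by rw [h0, zero_lie])
  have hb0 : b ≠ 0 := fun h0 => hc0 (by rw [h0, lie_zero])
  obtain ⟨D, hD⟩ := exists_restrict_inl hTI
  have hact : ∀ (l : LieAlgebra.SemiDirectSum I (Heisenberg F) ψ) w, ⁅l, LieAlgebra.SemiDirectSum.inl ψ w⁆ =
      LieAlgebra.SemiDirectSum.inl ψ (Heisenberg.op ψ l.right w) := by
    intro l w
    ext <;> simp [Heisenberg.op, trivial_lie_zero]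
  have hdeg : ∀ (l : LieAlgebra.SemiDirectSum I (Heisenberg F) ψ) (μ : F), T l = μ • l →
      D * Heisenberg.op ψ l.right - Heisenberg.op ψ l.right * D = μ • Heisenberg.op ψ l.right := by
    intro l μ hl
    ext w
    apply LieAlgebra.SemiDirectSum.inl_injective ψ
    have h1 := hTlie l (LieAlgebra.SemiDirectSum.inl ψ w)
    rw [hact, hD, hD, hact, hl, smul_lie, hact, ← sub_eq_iff_eq_add', ← map_sub, ← map_smul] at h1
    exact h1
  refine add_three_le_finrank hp (Heisenberg.op_lie ψ a.right b.right) (Heisenberg.op_lie_commute ψ _ _ _)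
    (Heisenberg.op_lie_commute ψ _ _ _) (hne a α ha ha0) (hne b β hb hb0) (hne _ _ hc hc0)
    (hdeg a α ha) (hdeg b β hb) (hdeg _ _ hc) (fun h0 => hab (hψ ?_)) fun ⟨nX, nY, nZ⟩ => hnil ?_
  · rw [map_zero]
    ext w
    exact LinearMap.congr_fun h0 w
  · refine isNilpotent_semiDirectSum ψ fun c => ?_
    obtain ⟨s, t, r, rfl⟩ := Heisenberg.exists_eq_combination hab c
    rw [Heisenberg.op_add, Heisenberg.op_add, Heisenberg.op_smul, Heisenberg.op_smul, Heisenberg.op_smul]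
    exact isNilpotent_combination (p := p) (Heisenberg.op_lie ψ _ _) (Heisenberg.op_lie_commute ψ _ _ _)
      (Heisenberg.op_lie_commute ψ _ _ _) nX nY nZ s t r

end LowerBound

/-! ### The representation of dimension p + 3. -/

section Example

namespace LieDerivation

variable {F : Type*} [Field F] {V : Type*} [LieRing V] [LieAlgebra F V] [IsLieAbelian V]

/-- Any linear operator is a derivation of an abelian Lie algebra. -/
def ofAbelian (T : End F V) : LieDerivation F V V where
  toLinearMap := T
  leibniz' a b := by simp [trivial_lie_zero]

@[simp]
theorem ofAbelian_apply (T : End F V) (v : V) : ofAbelian T v = T v := rfl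

/-- The representation of the Heisenberg algebra given by operators `X`, `Y` and `Z = [X, Y]`. -/
def heisenbergHom {X Y Z : End F V} (h : X * Y - Y * X = Z) (hX : Commute X Z)
    (hY : Commute Y Z) :
    Heisenberg F →ₗ⁅F⁆ LieDerivation F V V where
  toFun a := ofAbelian (a.cx • X + a.cy • Y + a.cz • Z)
  map_add' a b := by
    ext v
    simp only [Heisenberg.add_def, ofAbelian_apply, LieDerivation.add_apply, LinearMap.add_apply,
      LinearMap.smul_apply]
    module
  map_smul' s a := by
    ext v
    simp only [Heisenberg.smul_def, ofAbelian_apply, LieDerivation.smul_apply, LinearMap.add_apply,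
      LinearMap.smul_apply, RingHom.id_apply]
    module
  map_lie' {a b} := by
    ext v
    rw [LieDerivation.lie_apply]
    simp only [ofAbelian_apply]
    rw [← Module.End.mul_apply, ← Module.End.mul_apply, ← LinearMap.sub_apply]
    congr 1
    simp only [Heisenberg.lie_def, mul_add, add_mul, smul_mul_smul_comm, hX.eq, hY.eq]
    rw [← h]
    module

/-- The derivation of the semidirect sum that extends an operator `D` for which `X` and `Y` have
degree `1`. -/
def gradingDerivation {X Y Z D : End F V} (h : X * Y - Y * X = Z) (hX : Commute X Z)
    (hY : Commute Y Z) (hDX : D * X - X * D = X) (hDY : D * Y - Y * D = Y)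
    (hDZ : D * Z - Z * D = (2 : F) • Z) :
    LieDerivation F (LieAlgebra.SemiDirectSum V (Heisenberg F) (heisenbergHom h hX hY))
      (LieAlgebra.SemiDirectSum V (Heisenberg F) (heisenbergHom h hX hY)) where
  toFun l := ⟨D l.left, ⟨l.right.cx, l.right.cy, 2 * l.right.cz⟩⟩
  map_add' a b := by
    ext
    · exact map_add D _ _
    · rfl
    · rfl
    · exact mul_add _ _ _
  map_smul' s a := by
    ext
    · exact map_smul D s _
    · rfl
    · rfl
    · exact mul_left_comm _ _ _
  leibniz' a b := by
    have key : ∀ (c : Heisenberg F) (v : V),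
        D ((c.cx • X + c.cy • Y + c.cz • Z) v) = (c.cx • X + c.cy • Y + c.cz • Z) (D v) +
          (c.cx • X + c.cy • Y + (2 * c.cz) • Z) v := by
      intro c v
      have e1 : D (X v) = X (D v) + X v := by
        rw [← sub_eq_iff_eq_add']; exact LinearMap.congr_fun hDX v
      have e2 : D (Y v) = Y (D v) + Y v := by
        rw [← sub_eq_iff_eq_add']; exact LinearMap.congr_fun hDY v
      have e3 : D (Z v) = Z (D v) + (2 : F) • Z v := by
        rw [← sub_eq_iff_eq_add']; exact LinearMap.congr_fun hDZ v
      simp only [LinearMap.add_apply, LinearMap.smul_apply, map_add, map_smul, e1, e2, e3]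
      module
    ext
    · change D (⁅a.left, b.left⁆ + (a.right.cx • X + a.right.cy • Y + a.right.cz • Z) b.left -
          (b.right.cx • X + b.right.cy • Y + b.right.cz • Z) a.left) =
        (⁅a.left, D b.left⁆ + (a.right.cx • X + a.right.cy • Y + a.right.cz • Z) (D b.left) -
          (b.right.cx • X + b.right.cy • Y + (2 * b.right.cz) • Z) a.left) -
        (⁅b.left, D a.left⁆ + (b.right.cx • X + b.right.cy • Y + b.right.cz • Z) (D a.left) -
          (a.right.cx • X + a.right.cy • Y + (2 * a.right.cz) • Z) b.left)
      simp only [trivial_lie_zero]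
      rw [map_sub, map_add, map_zero, key, key]
      abel
    · exact (sub_self _).symm
    · exact (sub_self _).symm
    · change 2 * (a.right.cx * b.right.cy - a.right.cy * b.right.cx) =
        (a.right.cx * b.right.cy - a.right.cy * b.right.cx) -
          (b.right.cx * a.right.cy - b.right.cy * a.right.cx)
      ring

/-- The derivation acts by D on V and by 1, 1, 2 on x, y, z, so its order is governed by D and 2. -/
theorem hasNonsingularDerivation_heisenbergHom {X Y Z D : End F V} (h : X * Y - Y * X = Z)
    (hX : Commute X Z)
    (hY : Commute Y Z) (hDX : D * X - X * D = X) (hDY : D * Y - Y * D = Y)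
    (hDZ : D * Z - Z * D = (2 : F) • Z) {n : ℕ} (hn : 0 < n) (hDn : D ^ n = 1)
    (h2 : (2 : F) ^ n = 1) : HasNonsingularDerivation (heisenbergHom h hX hY) := by
  set δ := gradingDerivation h hX hY hDX hDY hDZ with hδ
  have hpow : ∀ (k : ℕ) l, (δ.toLinearMap ^ k : End F _) l =
      ⟨(D ^ k) l.left, ⟨l.right.cx, l.right.cy, 2 ^ k * l.right.cz⟩⟩ := by
    intro k l
    induction k with
    | zero => simp
    | succ k ih =>
      rw [pow_succ', Module.End.mul_apply, ih, pow_succ', pow_succ', Module.End.mul_apply, mul_assoc]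
      rfl
  have h1 : (δ.toLinearMap ^ n : End F _) = 1 := by
    ext1 l
    rw [hpow, hDn, h2, one_mul]
    rfl
  refine ⟨δ, ?_, isOfFinOrder_iff_pow_eq_one.2 ⟨n, hn, h1⟩, fun w => ⟨D w, ?_⟩⟩
  · have hu : IsUnit (δ.toLinearMap : End F _) := IsUnit.of_pow_eq_one h1 hn.ne'
    exact (Module.End.isUnit_iff _).1 hu
  · ext
    · rfl
    · rfl
    · rfl
    · exact (mul_zero (2 : F)).symm

end LieDerivation

section Operators

variable (F : Type*) [Field F] (p : ℕ)

/-- The underlying space of the module of dimension `p + 3`. -/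
abbrev HeisenbergSpace : Type _ := (ZMod p → F) × F × F × F

instance : LieRing (HeisenbergSpace F p) where
  bracket _ _ := 0
  add_lie _ _ _ := (add_zero _).symm
  lie_add _ _ _ := (add_zero _).symm
  lie_self _ := rfl
  leibniz_lie _ _ _ := (add_zero _).symm

instance : LieAlgebra F (HeisenbergSpace F p) where
  lie_smul t _ _ := (smul_zero t).symm

instance : IsLieAbelian (HeisenbergSpace F p) := ⟨fun _ _ => rfl⟩

/-- The cyclic shift, plus the matrix unit `E₁₂`. -/
def shiftX : End F (HeisenbergSpace F p) where
  toFun v := (fun i => v.1 (i - 1), v.2.2.1, 0, 0)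
  map_add' _ _ := by ext <;> simp
  map_smul' _ _ := by ext <;> simp

/-- The matrix unit `E₂₃`. -/
def unitY : End F (HeisenbergSpace F p) where
  toFun v := (0, 0, v.2.2.2, 0)
  map_add' _ _ := by ext <;> simp
  map_smul' _ _ := by ext <;> simp

/-- The matrix unit `E₁₃`. -/
def unitZ : End F (HeisenbergSpace F p) where
  toFun v := (0, v.2.2.2, 0, 0)
  map_add' _ _ := by ext <;> simp
  map_smul' _ _ := by ext <;> simp

/-- The diagonal operator with weights `lam + i`, and `lam + 2`, `lam + 1`, `lam`. -/
def weightD [Algebra (ZMod p) F] (lam : F) : End F (HeisenbergSpace F p) where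
  toFun v := (fun i => (lam + algebraMap (ZMod p) F i) * v.1 i,
    (lam + 2) * v.2.1, (lam + 1) * v.2.2.1, lam * v.2.2.2)
  map_add' _ _ := by ext <;> simp [mul_add]
  map_smul' _ _ := by ext <;> simp [mul_left_comm]

variable {F p}

theorem shiftX_lie_unitY : shiftX F p * unitY F p - unitY F p * shiftX F p = unitZ F p := by
  refine LinearMap.ext fun v => ?_
  ext <;> simp [shiftX, unitY, unitZ]

theorem shiftX_commute_unitZ : Commute (shiftX F p) (unitZ F p) := by
  refine LinearMap.ext fun v => ?_
  ext <;> simp [shiftX, unitZ]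

theorem unitY_commute_unitZ : Commute (unitY F p) (unitZ F p) := by
  refine LinearMap.ext fun v => ?_
  ext <;> simp [unitY, unitZ]

variable [Algebra (ZMod p) F] (lam : F)

/-- The shift raises the weight λ + i by 1; going round the cycle is consistent because i lives in
`ZMod p`. -/
theorem weightD_lie_shiftX :
    weightD F p lam * shiftX F p - shiftX F p * weightD F p lam = shiftX F p := by
  refine LinearMap.ext fun v => ?_
  ext <;> simp [shiftX, weightD] <;> ring

theorem weightD_lie_unitY :
    weightD F p lam * unitY F p - unitY F p * weightD F p lam = unitY F p := by
  refine LinearMap.ext fun v => ?_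
  ext <;> simp [unitY, weightD]; ring

theorem weightD_lie_unitZ :
    weightD F p lam * unitZ F p - unitZ F p * weightD F p lam = (2 : F) • unitZ F p := by
  refine LinearMap.ext fun v => ?_
  ext <;> simp [unitZ, weightD]; ring

theorem weightD_pow (n : ℕ) (v : HeisenbergSpace F p) :
    (weightD F p lam ^ n) v = (fun i => (lam + algebraMap (ZMod p) F i) ^ n * v.1 i,
      (lam + 2) ^ n * v.2.1, (lam + 1) ^ n * v.2.2.1, lam ^ n * v.2.2.2) := by
  induction n with
  | zero => simp
  | succ n ih =>
    rw [pow_succ', Module.End.mul_apply, ih]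
    ext <;> simp [weightD, pow_succ'] <;> ring

theorem weightD_pow_eq_one {n : ℕ} (h : ∀ i : ZMod p, (lam + algebraMap (ZMod p) F i) ^ n = 1) :
    weightD F p lam ^ n = 1 := by
  refine LinearMap.ext fun v => ?_
  have h0 := h 0
  have h1 := h 1
  have h2 := h 2
  rw [map_zero, add_zero] at h0
  rw [map_one] at h1
  rw [map_ofNat] at h2
  rw [weightD_pow]
  simp [h, h0, h1, h2]

/-- There are non-zero weights outside of the prime field. -/
theorem exists_weight [Fact p.Prime] (hp : Odd p) [CharP F p] [IsAlgClosed F] :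
    ∃ lam : F, ∀ i : ZMod p, (lam + algebraMap (ZMod p) F i) ^ (p ^ 2 - 1) = 1 := by
  have hp2 := (Fact.out : p.Prime).two_le
  -- λ^(p-1) = -1 makes Frobenius negate λ, so λ lies in 𝔽_{p²} but not in 𝔽_p, and each λ + i is a
  -- non-zero element of 𝔽_{p²}.
  obtain ⟨lam, hlam⟩ := IsAlgClosed.exists_pow_nat_eq (-1 : F) (n := p - 1) (by omega)
  have hfrob : lam ^ p = -lam := by
    obtain ⟨k, rfl⟩ : ∃ k, p = k + 1 := ⟨p - 1, by omega⟩
    rw [pow_succ, show k = k + 1 - 1 by omega, hlam, neg_one_mul]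
  have h2 : (2 : F) ≠ 0 := by
    intro h
    have := (CharP.cast_eq_zero_iff F p 2).1 (by exact_mod_cast h)
    have := Nat.le_of_dvd two_pos this
    obtain ⟨k, rfl⟩ := hp
    omega
  have hi : ∀ i : ZMod p, (algebraMap (ZMod p) F i) ^ p = algebraMap (ZMod p) F i := fun i => by
    rw [← map_pow, ZMod.pow_card]
  refine ⟨lam, fun i => ?_⟩
  set t := lam + algebraMap (ZMod p) F i with ht
  have ht1 : t ^ p = -lam + algebraMap (ZMod p) F i := by
    rw [ht, add_pow_char, hfrob, hi]
  have ht2 : t ^ (p ^ 2) = t := by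
    rw [pow_two, pow_mul, ht1, add_pow_char, hi, hp.neg_pow, hfrob, neg_neg]
  have ht0 : t ≠ 0 := by
    intro h0
    have h3 : 2 * lam = 0 := by
      rw [h0, zero_pow (by omega)] at ht1
      linear_combination ht1 + h0 - ht
    have h4 := (mul_eq_zero.1 h3).resolve_left h2
    rw [h4, zero_pow (by omega)] at hlam
    exact one_ne_zero (neg_eq_zero.1 hlam.symm)
  have hq : p ^ 2 = (p ^ 2 - 1) + 1 := by
    have := pow_pos (show 0 < p by omega) 2
    omega
  rw [hq, pow_succ] at ht2
  exact mul_right_cancel₀ ht0 (by rw [ht2, one_mul])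

/-- The representation of dimension `p + 3`. -/
def heisenbergRep (F : Type*) [Field F] (p : ℕ) :
    Heisenberg F →ₗ⁅F⁆ LieDerivation F (HeisenbergSpace F p)
      (HeisenbergSpace F p) :=
  LieDerivation.heisenbergHom shiftX_lie_unitY shiftX_commute_unitZ unitY_commute_unitZ

theorem heisenbergRep_apply (F : Type*) [Field F] (p : ℕ) (a : Heisenberg F)
    (v : HeisenbergSpace F p) : heisenbergRep F p a v =
      (a.cx • shiftX F p + a.cy • unitY F p + a.cz • unitZ F p) v := rfl

theorem heisenbergRep_injective (F : Type*) [Field F] (p : ℕ) :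
    Function.Injective (heisenbergRep F p) := by
  rw [injective_iff_map_eq_zero]
  intro a ha
  have h1 : (a.cx • shiftX F p + a.cy • unitY F p + a.cz • unitZ F p)
      ((0, 0, 1, 0) : HeisenbergSpace F p) = 0 := by rw [← heisenbergRep_apply, ha]; rfl
  have h2 : (a.cx • shiftX F p + a.cy • unitY F p + a.cz • unitZ F p)
      ((0, 0, 0, 1) : HeisenbergSpace F p) = 0 := by rw [← heisenbergRep_apply, ha]; rfl
  ext
  · simpa [shiftX, unitY, unitZ, Heisenberg.zero_def] using congrArg (fun v => v.2.1) h1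
  · simpa [shiftX, unitY, unitZ, Heisenberg.zero_def] using congrArg (fun v => v.2.2.1) h2
  · simpa [shiftX, unitY, unitZ, Heisenberg.zero_def] using congrArg (fun v => v.2.1) h2

/-- The constant vector is fixed by the shift, so ad x has eigenvalue 1. -/
theorem not_isNilpotent_heisenbergRep (F : Type*) [Field F] (p : ℕ) :
    ¬ LieRing.IsNilpotent (LieAlgebra.SemiDirectSum (HeisenbergSpace F p)
      (Heisenberg F) (heisenbergRep F p)) := by
  intro hnil
  obtain ⟨k, hk⟩ := LieModule.isNilpotent_toEnd_of_isNilpotent F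
    (LieAlgebra.SemiDirectSum (HeisenbergSpace F p) (Heisenberg F) (heisenbergRep F p))
    (LieAlgebra.SemiDirectSum (HeisenbergSpace F p) (Heisenberg F) (heisenbergRep F p))
    (LieAlgebra.SemiDirectSum.inr _ (Heisenberg.x F))
  let e : HeisenbergSpace F p := ((fun _ => 1, 0, 0, 0) : HeisenbergSpace F p)
  have hfix : ⁅LieAlgebra.SemiDirectSum.inr (heisenbergRep F p) (Heisenberg.x F),
      LieAlgebra.SemiDirectSum.inl (heisenbergRep F p) e⁆ =
      LieAlgebra.SemiDirectSum.inl (heisenbergRep F p) e := by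
    have he : heisenbergRep F p (Heisenberg.x F) e = e := by
      refine (heisenbergRep_apply F p _ _).trans ?_
      simp [Heisenberg.x, e, shiftX]
    simp [he]
  have hpow : ∀ n : ℕ, ((LieModule.toEnd F _ _
      (LieAlgebra.SemiDirectSum.inr (heisenbergRep F p) (Heisenberg.x F))) ^ n)
      (LieAlgebra.SemiDirectSum.inl (heisenbergRep F p) e) =
      LieAlgebra.SemiDirectSum.inl (heisenbergRep F p) e := by
    intro n
    induction n with
    | zero => simp
    | succ n ih => rw [pow_succ', Module.End.mul_apply, ih]; exact hfix
  have h0 := hpow k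
  rw [hk] at h0
  have h1 : (0 : HeisenbergSpace F p) = (fun _ => 1, 0, 0, 0) :=
    congrArg LieAlgebra.SemiDirectSum.left h0
  exact zero_ne_one (congrFun (congrArg Prod.fst h1) 0)

theorem hasNonsingularDerivation_heisenbergRep (F : Type*) [Field F] {p : ℕ} [Fact p.Prime]
    (hp : Odd p) [Algebra (ZMod p) F] [CharP F p] [IsAlgClosed F] :
    HasNonsingularDerivation (heisenbergRep F p) := by
  obtain ⟨lam, hlam⟩ := exists_weight (F := F) hp
  have hp2 := (Fact.out : p.Prime).two_le
  have hpp : 1 < p ^ 2 := Nat.one_lt_pow two_ne_zero (by omega)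
  have h2 : (2 : F) ^ (p ^ 2 - 1) = 1 := by
    have h2' : (2 : ZMod p) ≠ 0 := by
      intro h
      have := (CharP.cast_eq_zero_iff (ZMod p) p 2).1 (by exact_mod_cast h)
      have := Nat.le_of_dvd two_pos this
      obtain ⟨k, rfl⟩ := hp
      omega
    have hf : p ^ 2 - 1 = (p - 1) * (p + 1) := by
      rw [mul_comm, ← Nat.sq_sub_sq, one_pow]
    rw [← map_ofNat (algebraMap (ZMod p) F), ← map_pow, hf, pow_mul, ZMod.pow_card_sub_one_eq_one h2',
      one_pow, map_one]
  exact LieDerivation.hasNonsingularDerivation_heisenbergHom _ _ _ (weightD_lie_shiftX lam)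
    (weightD_lie_unitY lam) (weightD_lie_unitZ lam) (by omega) (weightD_pow_eq_one lam hlam) h2

theorem rank_heisenbergSpace (F : Type u) [Field F] (p : ℕ) [NeZero p] :
    Module.rank F (HeisenbergSpace F p) = ((p + 3 : ℕ) : Cardinal.{u}) := by
  rw [← Module.finrank_eq_rank]
  simp [ZMod.card]

end Operators

end Example

/-- A representation of `H` on a vector space `I` is a homomorphism `ψ : H → Der I = gl I`,
where `I` is regarded as an abelian Lie algebra. -/
theorem theorem7p3 {p : ℕ} [Fact p.Prime] (hp : Odd p)
    {F : Type u} [Field F] [Algebra (ZMod p) F] [IsAlgClosure (ZMod p) F] :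
    (∀ (I : Type v) [LieRing I] [LieAlgebra F I] [IsLieAbelian I]
        (ψ : Heisenberg F →ₗ⁅F⁆ LieDerivation F I I),
        Function.Injective ψ →
        ¬ LieRing.IsNilpotent (LieAlgebra.SemiDirectSum I (Heisenberg F) ψ) →
        HasNonsingularDerivation ψ →
        ((p + 3 : ℕ) : Cardinal.{v}) ≤ Module.rank F I) ∧
    (∃ (I : Type u) (_ : LieRing I) (_ : LieAlgebra F I) (_ : IsLieAbelian I)
        (ψ : Heisenberg F →ₗ⁅F⁆ LieDerivation F I I),
        Function.Injective ψ ∧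
        ¬ LieRing.IsNilpotent (LieAlgebra.SemiDirectSum I (Heisenberg F) ψ) ∧
        HasNonsingularDerivation ψ ∧
        Module.rank F I = ((p + 3 : ℕ) : Cardinal.{u})) := by
  have : IsAlgClosed F := IsAlgClosure.isAlgClosed (ZMod p)
  have : CharP F p := charP_of_injective_algebraMap (algebraMap (ZMod p) F).injective p
  refine ⟨fun I _ _ _ ψ hψ hnil hδ => ?_, ?_⟩
  · by_cases hfin : Module.rank F I < Cardinal.aleph0
    · have : FiniteDimensional F I := Module.rank_lt_aleph0_iff.1 hfin
      rw [← Module.finrank_eq_rank, Nat.cast_le]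
      exact add_three_le_finrank_of_hasNonsingularDerivation hp ψ hψ hnil hδ
    -- An infinite-dimensional I satisfies the bound trivially.
    · exact (Cardinal.natCast_lt_aleph0.le).trans (not_lt.1 hfin)
  · exact ⟨HeisenbergSpace F p, inferInstance, inferInstance, inferInstance,
      heisenbergRep F p, heisenbergRep_injective F p, not_isNilpotent_heisenbergRep F p,
      hasNonsingularDerivation_heisenbergRep F hp, rank_heisenbergSpace F p⟩
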